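/- \textbf{Setting.} Let $n\ge 1$ and let $w=(w_1,\dots,w_n)$ be an expected degree sequence, $w_1\ge w_2\ge\dots\ge w_n>0$ with $w_1\le\sqrt{\sum_k w_k}$. A $G(w)$ graph is a random undirected graph on $\{1,\dots,n\}$ in which each edge $\{i,j\}$ is present independently with probability $w_iw_j/\sum_k w_k$; self-loops $i=j$ may either be kept with this probability or be excluded (probability $0$), and the statement below covers both versions. Let $A\in\{0,1\}^{n\times n}$ be its symmetric adjacency matrix. Norms are Euclidean and $\log$ is the natural logarithm. Put $\tilde d=\sum_i w_i^2/\sum_i w_i$. For $\epsilon,\delta\in(0,1)$, the $G(w)$ distribution satisfies \emph{$(\epsilon,\delta)$-concentration} if $$\tfrac49\log(2n/\delta)\le w_1\le \tfrac{\|w\|}{6}\qquad\text{and}\qquad \tilde d\ \ge\ \frac{256\left(\sqrt{4w_1\log(2n/\delta)}+1\right)}{\epsilon^2}.$$ Let $\beta>0$ and let $b\in\mathbb R^n$ have entries $b_i\ge0$. An intervention $y\in\mathbb R^n$ changes the standalone marginal values from $b$ to $\hat b=b+y$. The agents then have utilities $u_i(a)=\hat b_ia_i-\tfrac12a_i^2+\beta\sum_jA_{ij}a_ia_j$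 and play the equilibrium actions $a^*=(I-\beta A)^{-1}\hat b$, the solution of $a^*=\hat b+\beta Aa^*$; the social welfare is $W(y)=\sum_iu_i(a^*)$. For a budget $C>0$, an optimal intervention $y^*$ is a maximizer of $W(y)$ subject to $\|y\|^2\le C$. \textbf{Theorem.} Suppose that the $G(w)$ distribution satisfies $(\epsilon,\delta)$-concentration and that $C>0$ satisfies $C\ge \dfrac{256\|b\|^2}{(\epsilon\beta\tilde d)^2}$. Then, with probability at least $1-\delta$ over the $G(w)$ graph, the following holds: if the spectral radius of $A$ is less than $1/\beta$, then an optimal intervention exists, and every optimal intervention $y^*$ satisfies $$\frac{W\!\left(\sqrt C\cdot w/\|w\|\right)}{W(y^*)}\ \ge\ 1-\epsilon .$$ -/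

import Mathlib

open MeasureTheory ProbabilityTheory
open scoped Matrix

/-! ### Linear-quadratic network games -/

namespace NetworkGame

variable {n : ℕ}

/-- Utility of agent `i` at the action profile `a`, in the game on the graph with adjacency
matrix `A`, with standalone marginal values `b` and interaction parameter `β`. -/
noncomputable def utility (A : Matrix (Fin n) (Fin n) ℝ) (β : ℝ) (b a : Fin n → ℝ)
    (i : Fin n) : ℝ :=
  b i * a i - 1 / 2 * a i ^ 2 + β * ∑ j, A i j * a i * a j

/-- Equilibrium actions: the solution `a = (I - βA)⁻¹ b` of `a = b + βAa`. -/
noncomputable def equilibrium (A : Matrix (Fin n) (Fin n) ℝ) (β : ℝ) (b : Fin n → ℝ) :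
    Fin n → ℝ :=
  (1 - β • A)⁻¹ *ᵥ b

/-- Social welfare `W(y) = ∑ i, u_i` at the equilibrium that follows the intervention `y`, which
changes the standalone marginal values from `b` to `b + y`. -/
noncomputable def welfare (A : Matrix (Fin n) (Fin n) ℝ) (β : ℝ)
    (b y : EuclideanSpace ℝ (Fin n)) : ℝ :=
  ∑ i, utility A β (fun k => b k + y k) (equilibrium A β fun k => b k + y k) i

/-- `y` maximizes the social welfare among all interventions of cost `‖y‖²` at most `C`. -/
def IsOptimalIntervention (A : Matrix (Fin n) (Fin n) ℝ) (β : ℝ)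
    (b : EuclideanSpace ℝ (Fin n)) (C : ℝ) (y : EuclideanSpace ℝ (Fin n)) : Prop :=
  ‖y‖ ^ 2 ≤ C ∧ ∀ x : EuclideanSpace ℝ (Fin n), ‖x‖ ^ 2 ≤ C → welfare A β b x ≤ welfare A β b y

end NetworkGame

/-! ### Random graphs with independent edges, and `G(w)` graphs -/

namespace RandomGraph

variable {n : ℕ}

/-- The law of a random undirected graph on `Fin n` (self-loops allowed) that contains each edge
`e` independently with probability `p e`. A graph is its edge-indicator function. -/
noncomputable def independentEdges (p : Sym2 (Fin n) → unitInterval) :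
    Measure (Sym2 (Fin n) → Bool) :=
  Measure.pi fun e => bernoulliMeasure true false (p e)

/-- Adjacency matrix of the graph with edge-indicator function `g`. -/
def adjacency (g : Sym2 (Fin n) → Bool) : Matrix (Fin n) (Fin n) ℝ :=
  Matrix.of fun i j => if g s(i, j) then 1 else 0

/-- Standing assumptions on an expected degree sequence `w₁ ≥ w₂ ≥ ⋯ ≥ wₙ` (here indexed from
`0`): the entries are positive and `w₁ ≤ √(∑ wₖ)`. -/
structure IsExpectedDegreeSequence [NeZero n] (w : EuclideanSpace ℝ (Fin n)) : Prop where
  antitone : ∀ i j : Fin n, i ≤ j → w j ≤ w i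
  pos : ∀ i, 0 < w i
  le_sqrt : w 0 ≤ √(∑ k, w k)

/-- Edge probabilities of the `G(w)` model: `wᵢwⱼ / ∑ wₖ`, except that self-loops have
probability zero if `loops = false`. -/
noncomputable def gwEdgeProb (loops : Bool) (w : EuclideanSpace ℝ (Fin n)) (e : Sym2 (Fin n)) : ℝ :=
  Sym2.lift ⟨fun i j => if i = j ∧ loops = false then 0 else w i * w j / ∑ k, w k,
    fun i j => by simp only [eq_comm (a := i) (b := j), mul_comm (w i)]⟩ e

/-- The law of a `G(w)` graph. The projection to `[0, 1]` has no effect for expected degree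
sequences, see `gwEdgeProb_mem`. -/
noncomputable def gw (loops : Bool) (w : EuclideanSpace ℝ (Fin n)) :
    Measure (Sym2 (Fin n) → Bool) :=
  independentEdges fun e => Set.projIcc 0 1 zero_le_one (gwEdgeProb loops w e)

theorem gwEdgeProb_mem [NeZero n] (loops : Bool) {w : EuclideanSpace ℝ (Fin n)}
    (hw : IsExpectedDegreeSequence w) (e : Sym2 (Fin n)) :
    gwEdgeProb loops w e ∈ Set.Icc (0 : ℝ) 1 := by
  induction e with
  | _ i j =>
    have hS : 0 < ∑ k, w k := Finset.sum_pos (fun k _ => hw.pos k) ⟨0, Finset.mem_univ _⟩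
    simp only [gwEdgeProb, Sym2.lift_mk]
    split_ifs
    · simp
    · refine ⟨div_nonneg (mul_nonneg (hw.pos i).le (hw.pos j).le) hS.le, ?_⟩
      rw [div_le_one hS]
      calc w i * w j ≤ √(∑ k, w k) * √(∑ k, w k) :=
            mul_le_mul ((hw.antitone 0 i (Fin.zero_le _)).trans hw.le_sqrt)
              ((hw.antitone 0 j (Fin.zero_le _)).trans hw.le_sqrt) (hw.pos j).le (Real.sqrt_nonneg _)
        _ = ∑ k, w k := Real.mul_self_sqrt hS.le

/-- Second-order average `d̃ = ∑ wᵢ² / ∑ wᵢ` of the expected degree sequence. -/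
noncomputable def secondOrderAverage (w : EuclideanSpace ℝ (Fin n)) : ℝ :=
  (∑ i, w i ^ 2) / ∑ i, w i

/-- `(ε, δ)`-concentration for `G(w)` graphs. -/
structure GwConcentration [NeZero n] (w : EuclideanSpace ℝ (Fin n)) (ε δ : ℝ) : Prop where
  eps_mem : ε ∈ Set.Ioo (0 : ℝ) 1
  delta_mem : δ ∈ Set.Ioo (0 : ℝ) 1
  le_maxDegree : 4 / 9 * Real.log (2 * n / δ) ≤ w 0
  maxDegree_le : w 0 ≤ ‖w‖ / 6
  le_secondOrderAverage :
    256 * (√(4 * w 0 * Real.log (2 * n / δ)) + 1) / ε ^ 2 ≤ secondOrderAverage w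

end RandomGraph

/-! At equilibrium the welfare is half the squared norm of `a = (1 - βA)⁻¹(b + y)`. Let `(r, u)` be
the top eigenpair of `A`. The resolvent has norm at most `1 / (1 - βr)` and multiplies the
`u`-component by exactly this factor. Hence `(1 - βr)² W(y) ≤ (‖b‖ + ‖y‖)² / 2` for all `y`
(`welfare_le`). For `y ≥ 0` also `(1 - βr)² W(y) ≥ ⟨u, y⟩² / 2` (`le_welfare`), because the
resolvent preserves nonnegativity. In the ratio of welfares the possibly huge amplification cancels,
so it suffices that `⟨u, w/‖w‖⟩²` is near 1 and that `‖b‖` is small against `√C`.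

Both follow once the quadratic form of `A` is within `ε² d̃ / 128` of that of the rank-one matrix
`d̃ v vᵀ`, `v = w/‖w‖` (`one_sub_le_welfare_div_welfare`). The mean of `A` differs from this matrix
by at most 1, and the fluctuation is controlled by a matrix Bernstein inequality
(`measure_adjacency_sub_le`). That inequality uses the matrix Laplace transform: Golden-Thompson
(`Matrix.trace_exp_add_le`) splits off one independent edge at a time, and a variance compensator in
the exponent keeps the expected trace at most `n` (`average_trace_exp_le`). -/

/-! ### The Lie-Trotter product formula -/

section LieTrotter

open Filter Topology NormedSpace

theorem norm_pow_sub_pow_le {R : Type*} [NormedRing R] [NormOneClass R] {X Y : R} {M : ℝ}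
    (hM : 1 ≤ M) (hX : ‖X‖ ≤ M) (hY : ‖Y‖ ≤ M) (k : ℕ) :
    ‖X ^ k - Y ^ k‖ ≤ k * M ^ k * ‖X - Y‖ := by
  have hM0 : 0 ≤ M := by linarith
  induction k with
  | zero => simp
  | succ k ih =>
    have h : X ^ (k + 1) - Y ^ (k + 1) = X ^ k * (X - Y) + (X ^ k - Y ^ k) * Y := by
      rw [pow_succ, pow_succ]; noncomm_ring
    have h1 : ‖X ^ k * (X - Y)‖ ≤ M ^ (k + 1) * ‖X - Y‖ := by
      refine (norm_mul_le _ _).trans (mul_le_mul_of_nonneg_right ?_ (norm_nonneg _))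
      exact (norm_pow_le _ _).trans ((pow_le_pow_left₀ (norm_nonneg _) hX k).trans
        (pow_le_pow_right₀ hM k.le_succ))
    have h2 : ‖(X ^ k - Y ^ k) * Y‖ ≤ k * M ^ k * ‖X - Y‖ * M :=
      (norm_mul_le _ _).trans (mul_le_mul ih hY (norm_nonneg _) (by positivity))
    rw [h]
    refine (norm_add_le _ _).trans ((add_le_add h1 h2).trans_eq ?_)
    push_cast
    ring

theorem NormedSpace.norm_exp_le_exp_norm {R : Type*} [NormedRing R] [NormOneClass R]
    [NormedAlgebra ℝ R] [CompleteSpace R] (x : R) : ‖exp x‖ ≤ Real.exp ‖x‖ := by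
  have h1 := norm_expSeries_summable' (𝕂 := ℝ) x
  rw [exp_eq_tsum ℝ, Real.exp_eq_exp_ℝ, exp_eq_tsum ℝ]
  refine (norm_tsum_le_tsum_norm h1).trans ?_
  refine h1.tsum_le_tsum (fun k => ?_) (expSeries_summable' (𝕂 := ℝ) ‖x‖)
  rw [norm_smul, smul_eq_mul, Real.norm_of_nonneg (by positivity)]
  gcongr
  exact norm_pow_le _ _

/-- The two curves `exp (tA) exp (tB)` and `exp (t(A + B))` agree to first order at 0, so at `t =
1/k` they differ by `o(1/k)`; taking `k`-th powers multiplies the difference by `O(k)`. -/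
theorem NormedSpace.tendsto_exp_mul_exp_pow {R : Type*} [NormedRing R] [NormOneClass R]
    [NormedAlgebra ℝ R] [CompleteSpace R] (A B : R) :
    Tendsto (fun k : ℕ => (exp ((k : ℝ)⁻¹ • A) * exp ((k : ℝ)⁻¹ • B)) ^ k) atTop
      (𝓝 (exp (A + B))) := by
  let _ : NormedAlgebra ℚ R := NormedAlgebra.restrictScalars ℚ ℝ R
  have hd : HasDerivAt (fun t : ℝ => exp (t • A) * exp (t • B) - exp (t • (A + B))) 0 0 := by
    have h := ((hasDerivAt_exp_smul_const A (0 : ℝ)).mul (hasDerivAt_exp_smul_const B (0 : ℝ))).sub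
      (hasDerivAt_exp_smul_const (A + B) (0 : ℝ))
    simpa [Pi.sub_def, Pi.mul_def] using h
  have hs : Tendsto (fun k : ℕ => (k : ℝ)⁻¹) atTop (𝓝[≠] 0) := by
    refine tendsto_nhdsWithin_iff.2 ⟨tendsto_inv_atTop_nhds_zero_nat, ?_⟩
    filter_upwards [eventually_gt_atTop 0] with k hk
    simp [hk.ne']
  have hl := ((hasDerivAt_iff_tendsto_slope.1 hd).comp hs).norm.const_mul
    (Real.exp (‖A‖ + ‖B‖))
  rw [norm_zero, mul_zero] at hl
  rw [tendsto_iff_norm_sub_tendsto_zero]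
  refine squeeze_zero' (Eventually.of_forall fun _ => norm_nonneg _) ?_ hl
  filter_upwards [eventually_gt_atTop 0] with k hk
  have hk' : (0 : ℝ) < k := by exact_mod_cast hk
  -- A common bound for both factors whose `k`-th power does not depend on `k`.
  set M := Real.exp ((k : ℝ)⁻¹ * (‖A‖ + ‖B‖))
  have hM : 1 ≤ M := Real.one_le_exp (by positivity)
  have hX : ‖exp ((k : ℝ)⁻¹ • A) * exp ((k : ℝ)⁻¹ • B)‖ ≤ M := by
    refine (norm_mul_le _ _).trans ((mul_le_mul (norm_exp_le_exp_norm _) (norm_exp_le_exp_norm _)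
      (norm_nonneg _) (by positivity)).trans_eq ?_)
    rw [← Real.exp_add, norm_smul, norm_smul, ← mul_add, Real.norm_of_nonneg (by positivity)]
  have hY : ‖exp ((k : ℝ)⁻¹ • (A + B))‖ ≤ M := by
    refine (norm_exp_le_exp_norm _).trans (Real.exp_le_exp.2 ?_)
    rw [norm_smul, Real.norm_of_nonneg (by positivity)]
    gcongr
    exact norm_add_le _ _
  have hMk : M ^ k = Real.exp (‖A‖ + ‖B‖) := by
    rw [← Real.exp_nat_mul, mul_inv_cancel_left₀ hk'.ne']
  have hYk : exp ((k : ℝ)⁻¹ • (A + B)) ^ k = exp (A + B) := by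
    rw [← exp_nsmul, ← Nat.cast_smul_eq_nsmul ℝ, smul_smul, mul_inv_cancel₀ hk'.ne', one_smul]
  have h := norm_pow_sub_pow_le hM hX hY k
  rw [hYk, hMk] at h
  refine h.trans_eq ?_
  simp only [Function.comp, slope_def_module, norm_smul]
  simp
  ring

end LieTrotter

/-! ### The Golden-Thompson inequality -/

section GoldenThompson

variable {m : Type*} [Fintype m]

theorem Matrix.trace_pow_mul_comm [DecidableEq m] (X Y : Matrix m m ℝ) (k : ℕ) :
    ((X * Y) ^ k).trace = ((Y * X) ^ k).trace := by
  cases k with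
  | zero => simp
  | succ k =>
    rw [pow_succ, ← Matrix.mul_assoc, mul_pow_mul, Matrix.trace_mul_comm,
      ← Matrix.mul_assoc, ← pow_succ']

theorem Matrix.two_mul_trace_mul_transpose_le (X Y : Matrix m m ℝ) :
    2 * (X * Yᵀ).trace ≤ (X * Xᵀ).trace + (Y * Yᵀ).trace := by
  simp only [Matrix.trace, Matrix.diag_apply, Matrix.mul_apply, Matrix.transpose_apply,
    Finset.mul_sum, ← Finset.sum_add_distrib]
  gcongr with i _ j _
  nlinarith [sq_nonneg (X i j - Y i j)]

/-- The two claims feed each other. Apply the first to `M ^ 2`, rotate cyclically to a product of `M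
* Mᵀ` and `Mᵀ * M`, then use the second and `2⟨X, Y⟩ ≤ ‖X‖² + ‖Y‖²`. For the second claim, apply the
first to `P * Q` and rotate to `P ^ 2 * Q ^ 2`. -/
theorem Matrix.trace_pow_two_pow_le [DecidableEq m] (k : ℕ) :
    (∀ M : Matrix m m ℝ, (M ^ 2 ^ (k + 1)).trace ≤ ((M * Mᵀ) ^ 2 ^ k).trace) ∧
    ∀ P Q : Matrix m m ℝ, P.IsSymm → Q.IsSymm →
      ((P * Q) ^ 2 ^ k).trace ≤ (P ^ 2 ^ k * Q ^ 2 ^ k).trace := by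
  induction k with
  | zero =>
    refine ⟨fun M => ?_, fun P Q _ _ => by simp⟩
    have h := Matrix.two_mul_trace_mul_transpose_le M Mᵀ
    rw [Matrix.transpose_transpose, Matrix.trace_mul_comm Mᵀ] at h
    simp only [zero_add, pow_one, pow_zero, pow_two]
    linarith
  | succ k ih =>
    refine ⟨fun M => ?_, fun P Q hP hQ => ?_⟩
    · have hQ : (M * Mᵀ).IsSymm := Matrix.isSymm_mul_transpose_self M
      have hP : (Mᵀ * M).IsSymm := Matrix.isSymm_transpose_mul_self M
      have h1 := ih.1 (M ^ 2)
      have h2 := ih.2 _ _ hQ hP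
      have h3 := Matrix.two_mul_trace_mul_transpose_le ((M * Mᵀ) ^ 2 ^ k) ((Mᵀ * M) ^ 2 ^ k)
      rw [Matrix.transpose_pow, Matrix.transpose_pow, hQ.eq, hP.eq, ← pow_add, ← pow_add, ← two_mul,
        ← pow_succ', Matrix.trace_pow_mul_comm Mᵀ M] at h3
      rw [← pow_mul, ← pow_succ'] at h1
      have h4 : ((M ^ 2 * (M ^ 2)ᵀ) ^ 2 ^ k).trace = ((M * Mᵀ * (Mᵀ * M)) ^ 2 ^ k).trace := by
        rw [Matrix.transpose_pow, pow_two, pow_two, Matrix.mul_assoc, Matrix.trace_pow_mul_comm]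
        simp only [Matrix.mul_assoc]
      linarith
    · have h1 := ih.1 (P * Q)
      have h2 := ih.2 (P ^ 2) (Q ^ 2) (hP.pow 2) (hQ.pow 2)
      have h4 : ((P * Q * (P * Q)ᵀ) ^ 2 ^ k).trace = ((P ^ 2 * Q ^ 2) ^ 2 ^ k).trace := by
        rw [Matrix.transpose_mul, hP.eq, hQ.eq, Matrix.mul_assoc, Matrix.trace_pow_mul_comm,
          Matrix.trace_pow_mul_comm (P ^ 2)]
        simp only [Matrix.mul_assoc, pow_two]
      rw [← pow_mul, ← pow_mul, ← pow_succ'] at h2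
      linarith

open NormedSpace in
open scoped Matrix.Norms.L2Operator in
/-- The **Golden-Thompson inequality** for real symmetric matrices. -/
theorem Matrix.trace_exp_add_le [DecidableEq m] {A B : Matrix m m ℝ} (hA : A.IsSymm)
    (hB : B.IsSymm) : (exp (A + B)).trace ≤ (exp A * exp B).trace := by
  -- Matrices of size zero have `‖1‖ = 0`, so `NormOneClass` needs a nonempty index type.
  rcases isEmpty_or_nonempty m with hm | hm
  · simp [Matrix.trace]
  -- Lie-Trotter along the exponents `2 ^ k`, where the trace inequality for powers is available.
  have h := ((continuous_id.matrix_trace (n := m) (R := ℝ)).tendsto (exp (A + B))).comp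
    ((NormedSpace.tendsto_exp_mul_exp_pow A B).comp
      (tendsto_pow_atTop_atTop_of_one_lt (r := (2 : ℕ)) one_lt_two))
  refine le_of_tendsto' h fun k => ?_
  have hk := (Matrix.trace_pow_two_pow_le k).2 _ _ (hA.smul ((2 ^ k : ℕ) : ℝ)⁻¹).exp
    (hB.smul ((2 ^ k : ℕ) : ℝ)⁻¹).exp
  have hpow : ∀ X : Matrix m m ℝ, exp (((2 ^ k : ℕ) : ℝ)⁻¹ • X) ^ 2 ^ k = exp X := fun X => by
    rw [← Matrix.exp_nsmul, ← Nat.cast_smul_eq_nsmul ℝ, smul_smul,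
      mul_inv_cancel₀ (by positivity), one_smul]
  rw [hpow, hpow] at hk
  exact hk

end GoldenThompson

/-! ### Spectral bounds for symmetric matrices -/

section SpectralBounds


variable {m : Type*} [Fintype m] [DecidableEq m] {A : Matrix m m ℝ}

theorem Matrix.IsSymm.posSemidef_exp (hA : A.IsSymm) : (NormedSpace.exp A).PosSemidef := by
  have h : NormedSpace.exp A =
      NormedSpace.exp ((1 / 2 : ℝ) • A) * (NormedSpace.exp ((1 / 2 : ℝ) • A))ᴴ := by
    rw [Matrix.conjTranspose_eq_transpose_of_trivial, ((hA.smul (1 / 2 : ℝ)).exp).eq,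
      ← Matrix.exp_add_of_commute _ _ (Commute.refl _), ← add_smul]
    norm_num
  rw [h]
  exact Matrix.posSemidef_self_mul_conjTranspose _

theorem Matrix.IsHermitian.exp_eq_conjStarAlgAut (hA : A.IsHermitian) :
    NormedSpace.exp A = Unitary.conjStarAlgAut ℝ _ hA.eigenvectorUnitary
      (Matrix.diagonal fun i => Real.exp (hA.eigenvalues i)) := by
  conv_lhs => rw [hA.spectral_theorem]
  simp only [Unitary.conjStarAlgAut_apply]
  have hU : IsUnit (hA.eigenvectorUnitary : Matrix m m ℝ) :=
    (Unitary.toUnits hA.eigenvectorUnitary).isUnit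
  have hi : (star hA.eigenvectorUnitary : Matrix m m ℝ) =
      (hA.eigenvectorUnitary : Matrix m m ℝ)⁻¹ :=
    (Matrix.inv_eq_left_inv (by simp)).symm
  rw [hi, Matrix.exp_conj _ _ hU, Matrix.exp_diagonal]
  congr 3
  ext i
  simp [Real.exp_eq_exp_ℝ]

theorem Matrix.PosSemidef.conjStarAlgAut (hA : A.PosSemidef) (U : Matrix.unitaryGroup m ℝ) :
    (Unitary.conjStarAlgAut ℝ _ U A).PosSemidef := by
  rw [Unitary.conjStarAlgAut_apply]
  exact hA.mul_mul_conjTranspose_same _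

theorem Matrix.IsHermitian.posSemidef_of_eigenvalues (hA : A.IsHermitian) (f : ℝ → ℝ)
    (hf : ∀ i, 0 ≤ f (hA.eigenvalues i)) : (Unitary.conjStarAlgAut ℝ _ hA.eigenvectorUnitary
      (Matrix.diagonal fun i => f (hA.eigenvalues i))).PosSemidef :=
  (Matrix.PosSemidef.diagonal (fun i => hf i)).conjStarAlgAut _

/-- The scalar inequality `exp x ≤ 1 + x + x²` for `|x| ≤ 1`, applied to the eigenvalues. -/
theorem Matrix.IsHermitian.posSemidef_one_add_self_add_sq_sub_exp (hA : A.IsHermitian)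
    (h1 : ∀ i, |hA.eigenvalues i| ≤ 1) : (1 + A + A ^ 2 - NormedSpace.exp A).PosSemidef := by
  have h : 1 + A + A ^ 2 - NormedSpace.exp A = Unitary.conjStarAlgAut ℝ _ hA.eigenvectorUnitary
      (Matrix.diagonal fun i => 1 + hA.eigenvalues i + hA.eigenvalues i ^ 2 -
        Real.exp (hA.eigenvalues i)) := by
    rw [hA.exp_eq_conjStarAlgAut]
    nth_rw 1 2 [hA.spectral_theorem]
    rw [← map_one (Unitary.conjStarAlgAut ℝ _ hA.eigenvectorUnitary), ← map_pow, ← map_add,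
      ← map_add, ← map_sub]
    congr 1
    ext i j
    by_cases hij : i = j <;> simp [hij, Matrix.diagonal_pow]
  rw [h]
  refine hA.posSemidef_of_eigenvalues (fun x => 1 + x + x ^ 2 - Real.exp x) fun i => ?_
  have h2 := (abs_le.1 (Real.abs_exp_sub_one_sub_id_le (h1 i))).2
  linarith

theorem Matrix.IsHermitian.trace_exp (hA : A.IsHermitian) :
    (NormedSpace.exp A).trace = ∑ i, Real.exp (hA.eigenvalues i) := by
  rw [hA.exp_eq_conjStarAlgAut, Unitary.conjStarAlgAut_apply, Matrix.trace_mul_cycle]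
  simp

theorem Matrix.IsHermitian.dotProduct_mulVec_le (hA : A.IsHermitian) {t : ℝ}
    (h : ∀ i, hA.eigenvalues i ≤ t) (x : m → ℝ) : x ⬝ᵥ A *ᵥ x ≤ t * (x ⬝ᵥ x) := by
  have h1 : t • 1 - A = Unitary.conjStarAlgAut ℝ _ hA.eigenvectorUnitary
      (Matrix.diagonal fun i => t - hA.eigenvalues i) := by
    nth_rw 1 [hA.spectral_theorem]
    rw [← map_one (Unitary.conjStarAlgAut ℝ _ hA.eigenvectorUnitary), ← map_smul, ← map_sub]
    congr 1
    ext i j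
    by_cases hij : i = j <;> simp [hij]
  have h2 := hA.posSemidef_of_eigenvalues (fun x => t - x) fun i => sub_nonneg.2 (h i)
  rw [← h1] at h2
  have h3 := h2.dotProduct_mulVec_nonneg x
  simpa [Matrix.sub_mulVec, Matrix.smul_mulVec] using h3

/-- Each `exp λᵢ` is one term of a positive sum, so a bound on the trace bounds the largest
eigenvalue. -/
theorem Matrix.IsHermitian.dotProduct_mulVec_le_of_trace_exp_le (hA : A.IsHermitian) {t : ℝ}
    (h : (NormedSpace.exp A).trace ≤ Real.exp t) (x : m → ℝ) : x ⬝ᵥ A *ᵥ x ≤ t * (x ⬝ᵥ x) := by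
  refine hA.dotProduct_mulVec_le (fun i => ?_) x
  rw [hA.trace_exp] at h
  exact Real.exp_le_exp.1 ((Finset.single_le_sum (f := fun i => Real.exp (hA.eigenvalues i))
    (fun _ _ => (Real.exp_pos _).le) (Finset.mem_univ i)).trans h)

open scoped MatrixOrder in
theorem Matrix.PosSemidef.trace_mul_nonneg {B : Matrix m m ℝ} (hA : A.PosSemidef)
    (hB : B.PosSemidef) : 0 ≤ (A * B).trace := by
  obtain ⟨C, rfl⟩ := CStarAlgebra.nonneg_iff_eq_star_mul_self.1 hA.nonneg
  rw [Matrix.mul_assoc, Matrix.trace_mul_comm]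
  exact (hB.mul_mul_conjTranspose_same C).trace_nonneg

end SpectralBounds

theorem Matrix.IsHermitian.abs_eigenvalues_le {m : Type*} [Fintype m] [DecidableEq m]
    {A : Matrix m m ℝ} (hA : A.IsHermitian) {c : ℝ}
    (h : ∀ x : m → ℝ, |x ⬝ᵥ A *ᵥ x| ≤ c * (x ⬝ᵥ x)) (i : m) : |hA.eigenvalues i| ≤ c := by
  have h1 := h (hA.eigenvectorBasis i)
  have h2 : (hA.eigenvectorBasis i).ofLp ⬝ᵥ (hA.eigenvectorBasis i).ofLp = 1 := by
    have := hA.eigenvectorBasis.inner_eq_one i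
    rwa [EuclideanSpace.inner_eq_star_dotProduct, star_trivial] at this
  rwa [hA.mulVec_eigenvectorBasis, dotProduct_smul, h2, smul_eq_mul, mul_one, mul_one] at h1

/-! ### The matrix Laplace transform of a random graph -/

namespace RandomGraph

section EdgeMatrix

variable {m : Type*} [DecidableEq m]

/-- Adjacency matrix of the graph with the single edge `e`. -/
def edgeMatrix (e : Sym2 m) : Matrix m m ℝ := Matrix.of fun a b => if s(a, b) = e then 1 else 0

/-- Projection onto the coordinates of the end points of `e`. -/
def endpointProjection (e : Sym2 m) : Matrix m m ℝ :=
  Matrix.diagonal fun a => if a ∈ e then 1 else 0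

theorem edgeMatrix_isSymm (e : Sym2 m) : (edgeMatrix e).IsSymm := by
  ext a b
  simp [edgeMatrix, Sym2.eq_swap]

theorem endpointProjection_isSymm (e : Sym2 m) : (endpointProjection e).IsSymm :=
  Matrix.isSymm_diagonal _

theorem posSemidef_endpointProjection (e : Sym2 m) : (endpointProjection e).PosSemidef :=
  Matrix.PosSemidef.diagonal fun a => by dsimp; split_ifs <;> simp

/-- The contribution of the edge `e`, present with probability `p`, to the exponent of the matrix
Laplace transform, compensated by a multiple of its variance. -/
noncomputable def edgeExponent (θ p : ℝ) (e : Sym2 m) (x : Bool) : Matrix m m ℝ :=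
  (θ * ((if x then 1 else 0) - p)) • edgeMatrix e -
    (2 * θ ^ 2 * (p * (1 - p))) • endpointProjection e

theorem edgeExponent_isSymm (θ p : ℝ) (e : Sym2 m) (x : Bool) : (edgeExponent θ p e x).IsSymm :=
  ((edgeMatrix_isSymm e).smul _).sub ((endpointProjection_isSymm e).smul _)

variable [Fintype m]

/-- The matrix swaps the end points of `e`, an involution on them; for a loop it is already the
projection. -/
theorem edgeMatrix_mul_self (e : Sym2 m) :
    edgeMatrix e * edgeMatrix e = endpointProjection e := by
  ext a b
  simp only [Matrix.mul_apply, edgeMatrix, endpointProjection, Matrix.of_apply,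
    Matrix.diagonal_apply]
  by_cases ha : a ∈ e
  · obtain ⟨c, rfl⟩ := ha
    have h : s(c, b) = s(a, c) ↔ a = b := by rw [Sym2.eq_swap, Sym2.congr_left, eq_comm]
    simp only [Sym2.congr_right, ite_mul, one_mul, zero_mul, Finset.sum_ite_eq', Finset.mem_univ,
      if_true, h, Sym2.mem_mk_left]
  · have h : ∀ x, s(a, x) ≠ e := fun x hx => ha (hx ▸ Sym2.mem_mk_left a x)
    simp [h, ha]

theorem endpointProjection_mul_edgeMatrix (e : Sym2 m) :
    endpointProjection e * edgeMatrix e = edgeMatrix e := by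
  ext a b
  simp only [endpointProjection, edgeMatrix, Matrix.diagonal_mul, Matrix.of_apply]
  by_cases h : s(a, b) = e
  · simp [← h]
  · simp [h]

theorem edgeMatrix_mul_endpointProjection (e : Sym2 m) :
    edgeMatrix e * endpointProjection e = edgeMatrix e := by
  have h := congr_arg Matrix.transpose (endpointProjection_mul_edgeMatrix e)
  rwa [Matrix.transpose_mul, (edgeMatrix_isSymm e).eq, (endpointProjection_isSymm e).eq] at h

theorem endpointProjection_mul_self (e : Sym2 m) :
    endpointProjection e * endpointProjection e = endpointProjection e := by
  simp [endpointProjection]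

theorem dotProduct_endpointProjection_le (e : Sym2 m) (x : m → ℝ) :
    x ⬝ᵥ endpointProjection e *ᵥ x ≤ x ⬝ᵥ x := by
  simp only [endpointProjection, Matrix.mulVec_diagonal, dotProduct]
  refine Finset.sum_le_sum fun a _ => ?_
  split_ifs <;> nlinarith [mul_self_nonneg (x a)]

theorem abs_dotProduct_edgeMatrix_le (e : Sym2 m) (x : m → ℝ) :
    |x ⬝ᵥ edgeMatrix e *ᵥ x| ≤ x ⬝ᵥ x := by
  have h1 : (edgeMatrix e *ᵥ x) ⬝ᵥ (edgeMatrix e *ᵥ x) ≤ x ⬝ᵥ x := by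
    refine le_trans (le_of_eq ?_) (dotProduct_endpointProjection_le e x)
    rw [Matrix.dotProduct_mulVec, ← Matrix.mulVec_transpose, (edgeMatrix_isSymm e).eq,
      Matrix.mulVec_mulVec, edgeMatrix_mul_self, dotProduct_comm]
  have h2 : 0 ≤ (x - edgeMatrix e *ᵥ x) ⬝ᵥ (x - edgeMatrix e *ᵥ x) :=
    Finset.sum_nonneg fun _ _ => mul_self_nonneg _
  have h3 : 0 ≤ (x + edgeMatrix e *ᵥ x) ⬝ᵥ (x + edgeMatrix e *ᵥ x) :=
    Finset.sum_nonneg fun _ _ => mul_self_nonneg _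
  simp only [sub_dotProduct, dotProduct_sub, add_dotProduct, dotProduct_add,
    dotProduct_comm _ x] at h2 h3
  rw [abs_le]
  constructor <;> linarith

theorem smul_sub_smul_sq (c v : ℝ) (e : Sym2 m) :
    (c • edgeMatrix e - v • endpointProjection e) ^ 2 =
      (c ^ 2 + v ^ 2) • endpointProjection e - (2 * c * v) • edgeMatrix e := by
  simp only [pow_two, sub_mul, mul_sub, smul_mul_smul_comm, edgeMatrix_mul_self,
    endpointProjection_mul_edgeMatrix, edgeMatrix_mul_endpointProjection,
    endpointProjection_mul_self]
  module

theorem abs_dotProduct_edgeExponent_le {θ p : ℝ} (hθ : |θ| ≤ 1 / 2) (hp : p ∈ Set.Icc (0 : ℝ) 1)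
    (e : Sym2 m) (x : Bool) (z : m → ℝ) :
    |z ⬝ᵥ edgeExponent θ p e x *ᵥ z| ≤ 1 * (z ⬝ᵥ z) := by
  obtain ⟨hp0, hp1⟩ := hp
  have hz : 0 ≤ z ⬝ᵥ z := Finset.sum_nonneg fun _ _ => mul_self_nonneg _
  simp only [edgeExponent, Matrix.sub_mulVec, Matrix.smul_mulVec, dotProduct_sub, dotProduct_smul,
    smul_eq_mul]
  have h1 := abs_dotProduct_edgeMatrix_le e z
  have h2 := dotProduct_endpointProjection_le e z
  have h3 := (posSemidef_endpointProjection e).dotProduct_mulVec_nonneg z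
  rw [star_trivial] at h3
  have hc : |θ * ((if x then 1 else 0) - p)| ≤ 1 / 2 := by
    rw [abs_mul]
    have : |(if x then 1 else 0) - p| ≤ 1 := by
      rw [abs_le]; split_ifs <;> constructor <;> linarith
    nlinarith [abs_nonneg θ, abs_nonneg ((if x then 1 else 0) - p)]
  have hv0 : 0 ≤ 2 * θ ^ 2 * (p * (1 - p)) := by
    have := mul_nonneg hp0 (sub_nonneg.2 hp1); positivity
  have hv : 2 * θ ^ 2 * (p * (1 - p)) ≤ 1 / 2 := by
    have : θ ^ 2 ≤ 1 / 4 := by rw [← sq_abs]; nlinarith [abs_nonneg θ]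
    nlinarith [sq_nonneg (p - 1 / 2), sq_nonneg θ]
  refine (abs_sub _ _).trans ?_
  rw [abs_mul, abs_mul _ (z ⬝ᵥ endpointProjection e *ᵥ z), abs_of_nonneg h3, abs_of_nonneg hv0]
  have h4 := mul_le_mul hc h1 (abs_nonneg _) (by norm_num)
  have h5 := mul_le_mul hv h2 h3 (by norm_num)
  linarith

/-- By Golden-Thompson and `exp Y ≤ 1 + Y + Y²` it suffices to average `1 + Y + Y²`. With `q = p(1 -
p)` and `P` the projection, `Y` has mean `-2θ²q P` and `Y²` has mean `(θ²q + 4θ⁴q²) P`. The factor 2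
in the compensator thus pays for the variance and for its own square when `|θ| ≤ 1/2`. -/
theorem average_trace_exp_le {θ p : ℝ} (hθ : |θ| ≤ 1 / 2) (hp : p ∈ Set.Icc (0 : ℝ) 1)
    {H : Matrix m m ℝ} (hH : H.IsSymm) (e : Sym2 m) :
    p * (NormedSpace.exp (H + edgeExponent θ p e true)).trace +
      (1 - p) * (NormedSpace.exp (H + edgeExponent θ p e false)).trace ≤
        (NormedSpace.exp H).trace := by
  have hstep : ∀ x, (NormedSpace.exp (H + edgeExponent θ p e x)).trace ≤
      (NormedSpace.exp H * (1 + edgeExponent θ p e x + edgeExponent θ p e x ^ 2)).trace := by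
    intro x
    have hY := edgeExponent_isSymm θ p e x
    have hY' : (edgeExponent θ p e x).IsHermitian := by
      rw [Matrix.IsHermitian, Matrix.conjTranspose_eq_transpose_of_trivial]; exact hY
    refine (Matrix.trace_exp_add_le hH hY).trans ?_
    rw [← sub_nonneg, ← Matrix.trace_sub, ← mul_sub]
    exact hH.posSemidef_exp.trace_mul_nonneg (hY'.posSemidef_one_add_self_add_sq_sub_exp
      (hY'.abs_eigenvalues_le (abs_dotProduct_edgeExponent_le hθ hp e x)))
  have hsum : p • (1 + edgeExponent θ p e true + edgeExponent θ p e true ^ 2) +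
      (1 - p) • (1 + edgeExponent θ p e false + edgeExponent θ p e false ^ 2) =
      1 - (θ ^ 2 * (p * (1 - p)) * (1 - 4 * θ ^ 2 * (p * (1 - p)))) • endpointProjection e := by
    simp only [edgeExponent, smul_sub_smul_sq, if_true, Bool.false_eq_true, if_false]
    module
  obtain ⟨hp0, hp1⟩ := hp
  have hq : 0 ≤ p * (1 - p) := mul_nonneg hp0 (sub_nonneg.2 hp1)
  have hc : 0 ≤ θ ^ 2 * (p * (1 - p)) * (1 - 4 * θ ^ 2 * (p * (1 - p))) := by
    have : θ ^ 2 ≤ 1 / 4 := by rw [← sq_abs]; nlinarith [abs_nonneg θ]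
    refine mul_nonneg (by positivity) ?_
    nlinarith [sq_nonneg (p - 1 / 2), sq_nonneg θ]
  calc _ ≤ p * _ + (1 - p) * _ := add_le_add (mul_le_mul_of_nonneg_left (hstep true) hp0)
        (mul_le_mul_of_nonneg_left (hstep false) (sub_nonneg.2 hp1))
    _ = (NormedSpace.exp H * (1 - (θ ^ 2 * (p * (1 - p)) * (1 - 4 * θ ^ 2 * (p * (1 - p)))) •
          endpointProjection e)).trace := by
        rw [← hsum, mul_add (NormedSpace.exp H) (p • _), mul_smul_comm, mul_smul_comm,
          Matrix.trace_add, Matrix.trace_smul,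
          Matrix.trace_smul, smul_eq_mul, smul_eq_mul]
    _ ≤ _ := by
        rw [mul_sub, mul_one, mul_smul_comm, Matrix.trace_sub, Matrix.trace_smul, smul_eq_mul]
        have := hH.posSemidef_exp.trace_mul_nonneg (posSemidef_endpointProjection e)
        have := mul_nonneg hc this
        linarith

end EdgeMatrix

variable {n : ℕ}

theorem sum_edgeExponent_isSymm (θ : ℝ) (p : Sym2 (Fin n) → unitInterval)
    (s : Finset (Sym2 (Fin n))) (g : Sym2 (Fin n) → Bool) :
    (∑ e ∈ s, edgeExponent θ (p e) e (g e)).IsSymm := by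
  rw [Matrix.IsSymm, Matrix.transpose_sum]
  exact Finset.sum_congr rfl fun e _ => edgeExponent_isSymm _ _ _ _

/-- By independence the edges can be integrated out one by one, none of which increases the trace;
what remains is the trace of `exp 0`, which is `n`. -/
theorem lmarginal_trace_exp_le {θ : ℝ} (hθ : |θ| ≤ 1 / 2) (p : Sym2 (Fin n) → unitInterval)
    (s : Finset (Sym2 (Fin n))) (g : Sym2 (Fin n) → Bool) :
    lmarginal (fun e => bernoulliMeasure true false (p e)) s (fun g => ENNReal.ofReal
      (NormedSpace.exp (∑ e ∈ s, edgeExponent θ (p e) e (g e))).trace) g ≤ n := by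
  induction s using Finset.induction_on generalizing g with
  | empty => simp
  | insert e s he ih =>
    rw [lmarginal_insert' _ Measurable.of_discrete he]
    refine (lmarginal_mono ?_ g).trans (ih g)
    intro g
    have hH := sum_edgeExponent_isSymm θ p s g
    have hsum : ∀ x, ∑ f ∈ insert e s, edgeExponent θ (p f) f (Function.update g e x f) =
        (∑ f ∈ s, edgeExponent θ (p f) f (g f)) + edgeExponent θ (p e) e x := fun x => by
      rw [Finset.sum_insert he, Function.update_self, add_comm]
      congr 1
      refine Finset.sum_congr rfl fun f hf => ?_
      rw [Function.update_of_ne (by rintro rfl; exact he hf)]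
    simp only [hsum]
    rw [← ofReal_integral_eq_lintegral_ofReal Integrable.of_finite
      (ae_of_all _ fun x => (hH.add (edgeExponent_isSymm _ _ _ _)).posSemidef_exp.trace_nonneg),
      integral_bernoulliMeasure]
    exact ENNReal.ofReal_le_ofReal (average_trace_exp_le hθ (p e).2 hH e)

/-- Matrix Laplace transform tail bound. -/
theorem measure_exp_lt_trace_exp_le {θ : ℝ} (hθ : |θ| ≤ 1 / 2) (p : Sym2 (Fin n) → unitInterval)
    (t : ℝ) : independentEdges p {g | Real.exp t <
      (NormedSpace.exp (∑ e, edgeExponent θ (p e) e (g e))).trace} ≤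
        ENNReal.ofReal (n * Real.exp (-t)) := by
  have h := lmarginal_trace_exp_le hθ p Finset.univ (fun _ => false)
  rw [lmarginal_univ] at h
  have h2 := meas_ge_le_lintegral_div (μ := independentEdges p) (f := fun g => ENNReal.ofReal
      (NormedSpace.exp (∑ e, edgeExponent θ (p e) e (g e))).trace)
      (Measurable.of_discrete).aemeasurable (ε := ENNReal.ofReal (Real.exp t))
      (by simp [Real.exp_pos]) (by simp)
  refine (measure_mono fun g hg => ENNReal.ofReal_le_ofReal (le_of_lt hg)).trans (h2.trans ?_)
  refine (ENNReal.div_le_div_right h _).trans_eq ?_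
  rw [Real.exp_neg, ← div_eq_mul_inv, ENNReal.ofReal_div_of_pos (Real.exp_pos _),
    ENNReal.ofReal_natCast]

end RandomGraph

/-! ### Matrix Bernstein inequality for adjacency matrices -/

namespace RandomGraph

variable {n : ℕ}

/-- Writing the projection as the square of the edge matrix lists the edges at `a` by their other
end point, a loop exactly once. -/
theorem sum_mul_endpointProjection_apply {m : Type*} [Fintype m] [DecidableEq m]
    (f : Sym2 m → ℝ) (a : m) : ∑ e, f e * endpointProjection e a a = ∑ b, f s(a, b) := by
  simp only [← edgeMatrix_mul_self, Matrix.mul_apply, Finset.mul_sum]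
  rw [Finset.sum_comm]
  refine Finset.sum_congr rfl fun b _ => ?_
  simp [edgeMatrix, Sym2.eq_swap (a := b)]

theorem sum_edgeExponent (θ : ℝ) (p : Sym2 (Fin n) → unitInterval) (g : Sym2 (Fin n) → Bool) :
    ∑ e, edgeExponent θ (p e) e (g e) =
      θ • (adjacency g - Matrix.of fun a b => (p s(a, b) : ℝ)) -
        (2 * θ ^ 2) • Matrix.diagonal fun a => ∑ b, (p s(a, b) : ℝ) * (1 - p s(a, b)) := by
  have hP : ∀ a b, (∑ e, 2 * θ ^ 2 * ((p e : ℝ) * (1 - p e)) * endpointProjection e a b) =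
      (2 * θ ^ 2) * Matrix.diagonal (fun a => ∑ b, (p s(a, b) : ℝ) * (1 - p s(a, b))) a b := by
    intro a b
    by_cases h : a = b
    · subst h
      rw [sum_mul_endpointProjection_apply, Matrix.diagonal_apply_eq, Finset.mul_sum]
    · simp [endpointProjection, h]
  ext a b
  simp only [edgeExponent, Matrix.sum_apply, Matrix.sub_apply, Matrix.smul_apply, smul_eq_mul,
    Finset.sum_sub_distrib, hP, Matrix.of_apply, adjacency]
  congr 1
  simp [edgeMatrix]

theorem dotProduct_adjacency_sub_le {θ t Δ : ℝ} {p : Sym2 (Fin n) → unitInterval}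
    (hp : ∀ a, ∑ b, (p s(a, b) : ℝ) ≤ Δ) {g : Sym2 (Fin n) → Bool}
    (hg : (NormedSpace.exp (∑ e, edgeExponent θ (p e) e (g e))).trace ≤ Real.exp t)
    (x : Fin n → ℝ) :
    θ * (x ⬝ᵥ (adjacency g - Matrix.of fun a b => (p s(a, b) : ℝ)) *ᵥ x) ≤
      (t + 2 * θ ^ 2 * Δ) * (x ⬝ᵥ x) := by
  have hs : (∑ e, edgeExponent θ (p e) e (g e)).IsHermitian := by
    rw [Matrix.IsHermitian, Matrix.conjTranspose_eq_transpose_of_trivial]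
    exact sum_edgeExponent_isSymm θ p _ g
  have h := hs.dotProduct_mulVec_le_of_trace_exp_le hg x
  rw [sum_edgeExponent, Matrix.sub_mulVec, Matrix.smul_mulVec, Matrix.smul_mulVec, dotProduct_sub,
    dotProduct_smul, dotProduct_smul, smul_eq_mul, smul_eq_mul] at h
  have hD : x ⬝ᵥ (Matrix.diagonal fun a => ∑ b, (p s(a, b) : ℝ) * (1 - p s(a, b))) *ᵥ x ≤
      Δ * (x ⬝ᵥ x) := by
    simp only [Matrix.mulVec_diagonal, dotProduct, Finset.mul_sum]
    refine Finset.sum_le_sum fun a _ => ?_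
    have h1 : ∑ b, (p s(a, b) : ℝ) * (1 - p s(a, b)) ≤ Δ :=
      (Finset.sum_le_sum fun b _ => by nlinarith [(p s(a, b)).2.1]).trans (hp a)
    nlinarith [mul_self_nonneg (x a)]
  nlinarith [sq_nonneg θ]

/-- Matrix Bernstein inequality for the adjacency matrix of a random graph with independent
edges. -/
theorem measure_adjacency_sub_le {θ t Δ : ℝ} (hθ0 : 0 < θ) (hθ : θ ≤ 1 / 2)
    (p : Sym2 (Fin n) → unitInterval) (hp : ∀ a, ∑ b, (p s(a, b) : ℝ) ≤ Δ) :
    independentEdges p {g | ∀ x : Fin n → ℝ,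
      |x ⬝ᵥ (adjacency g - Matrix.of fun a b => (p s(a, b) : ℝ)) *ᵥ x| ≤
        (t / θ + 2 * θ * Δ) * (x ⬝ᵥ x)}ᶜ ≤ ENNReal.ofReal (2 * n * Real.exp (-t)) := by
  -- The parameters `θ` and `-θ` bound the form from above and from below; the union bound costs the
  -- factor 2.
  have h1 := measure_exp_lt_trace_exp_le (θ := θ) (by rwa [abs_of_pos hθ0]) p t
  have h2 := measure_exp_lt_trace_exp_le (θ := -θ) (by rwa [abs_neg, abs_of_pos hθ0]) p t
  have h3 := add_le_add h1 h2
  rw [← ENNReal.ofReal_add (by positivity) (by positivity)] at h3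
  refine (measure_mono ?_).trans ((measure_union_le _ _).trans (h3.trans_eq (by ring_nf)))
  rw [Set.compl_subset_comm]
  intro g hg x
  rw [Set.mem_compl_iff, Set.mem_union, not_or] at hg
  simp only [Set.mem_ofPred_eq, not_lt] at hg
  have k1 := dotProduct_adjacency_sub_le hp hg.1 x
  have k2 := dotProduct_adjacency_sub_le hp hg.2 x
  have k : t / θ + 2 * θ * Δ = (t + 2 * θ ^ 2 * Δ) / θ := by field_simp
  rw [k, div_mul_eq_mul_div, le_div_iff₀ hθ0, ← abs_of_pos hθ0, ← abs_mul, abs_of_pos hθ0, abs_le]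
  constructor <;> nlinarith

end RandomGraph

theorem sq_dotProduct_le {m : Type*} [Fintype m] (x y : m → ℝ) :
    (x ⬝ᵥ y) ^ 2 ≤ (x ⬝ᵥ x) * (y ⬝ᵥ y) := by
  have h := Finset.sum_mul_sq_le_sq_mul_sq Finset.univ x y
  simpa only [dotProduct, pow_two] using h

theorem EuclideanSpace.real_norm_sq_eq_dotProduct {m : Type*} [Fintype m]
    (x : EuclideanSpace ℝ m) : ‖x‖ ^ 2 = x.ofLp ⬝ᵥ x.ofLp := by
  rw [EuclideanSpace.real_norm_sq_eq]
  simp only [dotProduct, pow_two]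

/-! ### Welfare and the top eigenpair -/

namespace NetworkGame

variable {n : ℕ} {A : Matrix (Fin n) (Fin n) ℝ} {β : ℝ}

theorem beta_mul_eigenvalues_lt_one (hA : A.IsHermitian) (hβ : 0 < β)
    (hρ : spectralRadius ℝ A < ENNReal.ofReal (1 / β)) (i : Fin n) :
    β * hA.eigenvalues i < 1 := by
  have h : (‖hA.eigenvalues i‖₊ : ENNReal) ≤ spectralRadius ℝ A :=
    le_iSup₂ (f := fun k (_ : k ∈ spectrum ℝ A) => (‖k‖₊ : ENNReal)) _
      (hA.eigenvalues_mem_spectrum_real i)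
  have h1 := h.trans_lt hρ
  rw [← enorm_eq_nnnorm, Real.enorm_eq_ofReal_abs, ENNReal.ofReal_lt_ofReal_iff (by positivity),
    lt_div_iff₀ hβ] at h1
  nlinarith [le_abs_self (hA.eigenvalues i)]

/-- `r` and `u` are the largest eigenvalue and a corresponding unit eigenvector of the symmetric
matrix `A`. -/
structure IsTopEigenpair (A : Matrix (Fin n) (Fin n) ℝ) (r : ℝ) (u : Fin n → ℝ) : Prop where
  isHermitian : A.IsHermitian
  dotProduct_self : u ⬝ᵥ u = 1
  mulVec_eq : A *ᵥ u = r • u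
  le : ∀ x, x ⬝ᵥ A *ᵥ x ≤ r * (x ⬝ᵥ x)

theorem exists_isTopEigenpair [NeZero n] (hA : A.IsHermitian) (hβ : 0 < β)
    (hρ : spectralRadius ℝ A < ENNReal.ofReal (1 / β)) :
    ∃ r u, IsTopEigenpair A r u ∧ β * r < 1 := by
  obtain ⟨i, hi⟩ := Finite.exists_max hA.eigenvalues
  refine ⟨hA.eigenvalues i, hA.eigenvectorBasis i, ⟨hA, ?_, hA.mulVec_eigenvectorBasis i,
    hA.dotProduct_mulVec_le hi⟩, beta_mul_eigenvalues_lt_one hA hβ hρ i⟩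
  have := hA.eigenvectorBasis.inner_eq_one i
  rwa [EuclideanSpace.inner_eq_star_dotProduct, star_trivial] at this

namespace IsTopEigenpair

variable {r : ℝ} {u : Fin n → ℝ}

theorem isUnit_det (h : IsTopEigenpair A r u) (hβ : 0 < β) (hr : β * r < 1) :
    IsUnit (1 - β • A).det := by
  rw [← Matrix.isUnit_iff_isUnit_det]
  refine Matrix.PosDef.isUnit (Matrix.PosDef.of_dotProduct_mulVec_pos ?_ fun x hx => ?_)
  · exact Matrix.isHermitian_one.sub (h.isHermitian.smul (by simp [IsSelfAdjoint]))
  · have hx' : 0 < x ⬝ᵥ x := by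
      simpa using Matrix.dotProduct_star_self_pos_iff.2 hx
    rw [star_trivial, Matrix.sub_mulVec, Matrix.one_mulVec, Matrix.smul_mulVec, dotProduct_sub,
      dotProduct_smul, smul_eq_mul]
    nlinarith [h.le x]

theorem equilibrium_eq (h : IsTopEigenpair A r u) (hβ : 0 < β) (hr : β * r < 1)
    (c : Fin n → ℝ) : equilibrium A β c = c + β • A *ᵥ equilibrium A β c := by
  have h1 : (1 - β • A) *ᵥ equilibrium A β c = c := by
    rw [equilibrium, Matrix.mulVec_mulVec, Matrix.mul_nonsing_inv _ (h.isUnit_det hβ hr),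
      Matrix.one_mulVec]
  rw [Matrix.sub_mulVec, Matrix.one_mulVec, Matrix.smul_mulVec] at h1
  exact sub_eq_iff_eq_add.1 h1

/-- The equilibrium equation turns each utility into `aᵢ² - aᵢ² / 2`. -/
theorem welfare_eq (h : IsTopEigenpair A r u) (hβ : 0 < β) (hr : β * r < 1)
    (b y : EuclideanSpace ℝ (Fin n)) : welfare A β b y =
      1 / 2 * (equilibrium A β (b.ofLp + y.ofLp) ⬝ᵥ equilibrium A β (b.ofLp + y.ofLp)) := by
  have h1 := h.equilibrium_eq hβ hr (b.ofLp + y.ofLp)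
  have hc : (fun k => b k + y k) = b.ofLp + y.ofLp := rfl
  rw [welfare, hc, dotProduct, Finset.mul_sum]
  set a := equilibrium A β (b.ofLp + y.ofLp)
  refine Finset.sum_congr rfl fun i _ => ?_
  have h2 : a i = (b i + y i) + β * ∑ j, A i j * a j := by
    simpa [Matrix.mulVec, dotProduct] using congr_fun h1 i
  have h3 : ∑ j, A i j * a i * a j = a i * ∑ j, A i j * a j := by
    rw [Finset.mul_sum]
    exact Finset.sum_congr rfl fun j _ => by ring
  rw [utility, h3, Pi.add_apply]
  linear_combination (-a i) * h2

/-- Pairing the equilibrium equation with its solution `z` gives `(1 - βr)‖z‖² ≤ ⟨z, c⟩`; conclude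
by Cauchy-Schwarz. -/
theorem dotProduct_equilibrium_le (h : IsTopEigenpair A r u) (hβ : 0 < β) (hr : β * r < 1)
    (c : Fin n → ℝ) :
    (1 - β * r) ^ 2 * (equilibrium A β c ⬝ᵥ equilibrium A β c) ≤ c ⬝ᵥ c := by
  have h1 := congr_arg (equilibrium A β c ⬝ᵥ ·) (h.equilibrium_eq hβ hr c)
  set z := equilibrium A β c
  simp only [dotProduct_add, dotProduct_smul, smul_eq_mul] at h1
  have h2 := h.le z
  have h3 := sq_dotProduct_le z c
  have hz : 0 ≤ z ⬝ᵥ z := Finset.sum_nonneg fun _ _ => mul_self_nonneg _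
  have hc : 0 ≤ c ⬝ᵥ c := Finset.sum_nonneg fun _ _ => mul_self_nonneg _
  rcases hz.eq_or_lt with hz | hz
  · rw [← hz]; simpa using hc
  have h4 : (1 - β * r) * (z ⬝ᵥ z) ≤ z ⬝ᵥ c := by nlinarith
  have h5 : ((1 - β * r) * (z ⬝ᵥ z)) ^ 2 ≤ (z ⬝ᵥ c) ^ 2 :=
    pow_le_pow_left₀ (mul_nonneg (by linarith) hz.le) h4 2
  refine le_of_mul_le_mul_left ?_ hz
  nlinarith

theorem dotProduct_equilibrium (h : IsTopEigenpair A r u) (hβ : 0 < β) (hr : β * r < 1)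
    (c : Fin n → ℝ) : (1 - β * r) * (u ⬝ᵥ equilibrium A β c) = u ⬝ᵥ c := by
  have h1 := congr_arg (u ⬝ᵥ ·) (h.equilibrium_eq hβ hr c)
  have hA : Aᵀ = A := by
    rw [← Matrix.conjTranspose_eq_transpose_of_trivial]; exact h.isHermitian
  have h2 : u ⬝ᵥ A *ᵥ equilibrium A β c = r * (u ⬝ᵥ equilibrium A β c) := by
    rw [Matrix.dotProduct_mulVec, ← Matrix.mulVec_transpose, hA, h.mulVec_eq, smul_dotProduct,
      smul_eq_mul]
  simp only [dotProduct_add, dotProduct_smul, smul_eq_mul, h2] at h1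
  linear_combination h1

/-- Pairing the equation with the negative part `z⁻` of the solution gives `‖z⁻‖² ≤ β⟨z⁻, A z⁻⟩ ≤
βr‖z⁻‖²`, since the terms with `c` and `A z⁺` are nonnegative. As `βr < 1`, `z⁻ = 0`. -/
theorem equilibrium_nonneg (h : IsTopEigenpair A r u) (hβ : 0 < β) (hr : β * r < 1)
    (hA : ∀ i j, 0 ≤ A i j) {c : Fin n → ℝ} (hc : 0 ≤ c) : 0 ≤ equilibrium A β c := by
  have h1 := congr_arg ((equilibrium A β c)⁻ ⬝ᵥ ·) (h.equilibrium_eq hβ hr c)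
  set z := equilibrium A β c
  have hn : 0 ≤ z⁻ := negPart_nonneg z
  have hAp : 0 ≤ A *ᵥ z⁺ := fun i => by
    rw [Pi.zero_apply, Matrix.mulVec, dotProduct]
    exact Finset.sum_nonneg fun j _ => mul_nonneg (hA i j) (posPart_nonneg z j)
  have h2 : A *ᵥ z = A *ᵥ z⁺ - A *ᵥ z⁻ := by rw [← Matrix.mulVec_sub, posPart_sub_negPart]
  have h3 : z⁻ ⬝ᵥ z = -(z⁻ ⬝ᵥ z⁻) := by
    rw [dotProduct, dotProduct, ← Finset.sum_neg_distrib]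
    refine Finset.sum_congr rfl fun i _ => ?_
    rw [Pi.negPart_apply]
    rcases le_total (z i) 0 with hi | hi
    · rw [negPart_of_nonpos hi]; ring
    · rw [negPart_of_nonneg hi]; ring
  simp only [dotProduct_add, dotProduct_smul, smul_eq_mul, h2, dotProduct_sub, h3] at h1
  have h4 := dotProduct_nonneg_of_nonneg hn hc
  have h5 := mul_nonneg hβ.le (dotProduct_nonneg_of_nonneg hn hAp)
  have h6 := h.le z⁻
  have hz0 : 0 ≤ z⁻ ⬝ᵥ z⁻ := dotProduct_nonneg_of_nonneg hn hn
  have h7 : z⁻ ⬝ᵥ z⁻ = 0 := by nlinarith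
  exact negPart_eq_zero.1 (dotProduct_self_eq_zero.1 h7)

theorem exists_isOptimalIntervention (h : IsTopEigenpair A r u) (hβ : 0 < β) (hr : β * r < 1)
    (b : EuclideanSpace ℝ (Fin n)) {C : ℝ} (hC : 0 ≤ C) :
    ∃ y, IsOptimalIntervention A β b C y := by
  have hcont : Continuous (welfare A β b) := by
    have : welfare A β b = fun y => 1 / 2 * (equilibrium A β (b.ofLp + y.ofLp) ⬝ᵥ
        equilibrium A β (b.ofLp + y.ofLp)) := funext (h.welfare_eq hβ hr b)
    rw [this]
    have he : Continuous fun y : EuclideanSpace ℝ (Fin n) => equilibrium A β (b.ofLp + y.ofLp) :=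
      continuous_const.matrix_mulVec (by fun_prop)
    exact continuous_const.mul (he.dotProduct he)
  obtain ⟨y, hy, hmax⟩ := (isCompact_closedBall (0 : EuclideanSpace ℝ (Fin n))
    (√C)).exists_isMaxOn ⟨0, by simp⟩ hcont.continuousOn
  have hball : ∀ x : EuclideanSpace ℝ (Fin n),
      x ∈ Metric.closedBall (0 : EuclideanSpace ℝ (Fin n)) (√C) ↔ ‖x‖ ^ 2 ≤ C := fun x => by
    rw [mem_closedBall_zero_iff, Real.le_sqrt (norm_nonneg _) hC]
  exact ⟨y, (hball y).1 hy, fun x hx => hmax ((hball x).2 hx)⟩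

/-- The welfare of an intervention is at most what the top eigenvalue allows. -/
theorem welfare_le (h : IsTopEigenpair A r u) (hβ : 0 < β) (hr : β * r < 1)
    (b y : EuclideanSpace ℝ (Fin n)) :
    (1 - β * r) ^ 2 * welfare A β b y ≤ 1 / 2 * (‖b‖ + ‖y‖) ^ 2 := by
  have h1 := h.dotProduct_equilibrium_le hβ hr (b.ofLp + y.ofLp)
  have h2 : (b.ofLp + y.ofLp) ⬝ᵥ (b.ofLp + y.ofLp) = ‖b + y‖ ^ 2 := by
    rw [EuclideanSpace.real_norm_sq_eq_dotProduct, WithLp.ofLp_add]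
  have h3 := pow_le_pow_left₀ (norm_nonneg _) (norm_add_le b y) 2
  rw [h.welfare_eq hβ hr]
  linarith

/-- The equilibrium is the sum of those for `b` and for `y`, both nonnegative, so its norm is at
least that of the latter, hence at least the `u`-component of the latter. -/
theorem le_welfare (h : IsTopEigenpair A r u) (hβ : 0 < β) (hr : β * r < 1)
    (hA : ∀ i j, 0 ≤ A i j) {b y : EuclideanSpace ℝ (Fin n)} (hb : ∀ i, 0 ≤ b i)
    (hy : ∀ i, 0 ≤ y i) :
    1 / 2 * (u ⬝ᵥ y.ofLp) ^ 2 ≤ (1 - β * r) ^ 2 * welfare A β b y := by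
  have hadd : equilibrium A β (b.ofLp + y.ofLp) = equilibrium A β b + equilibrium A β y :=
    Matrix.mulVec_add _ _ _
  have hb' := h.equilibrium_nonneg hβ hr hA (c := b) hb
  have hy' := h.equilibrium_nonneg hβ hr hA (c := y) hy
  rw [h.welfare_eq hβ hr, hadd, ← h.dotProduct_equilibrium hβ hr y]
  simp only [dotProduct_add, add_dotProduct]
  have h1 := dotProduct_nonneg_of_nonneg hb' hb'
  have h2 := dotProduct_nonneg_of_nonneg hb' hy'
  have h3 := sq_dotProduct_le u (equilibrium A β y)
  rw [h.dotProduct_self, one_mul] at h3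
  rw [dotProduct_comm (equilibrium A β y.ofLp) (equilibrium A β b.ofLp), mul_pow]
  nlinarith [sq_nonneg (1 - β * r)]

/-- A rank-one approximation of the quadratic form of `A` locates its top eigenpair. -/
theorem le_sq_dotProduct (h : IsTopEigenpair A r u) {v : Fin n → ℝ} (hv : v ⬝ᵥ v = 1) {d K : ℝ}
    (hAv : ∀ x, |x ⬝ᵥ A *ᵥ x - d * (v ⬝ᵥ x) ^ 2| ≤ K * (x ⬝ᵥ x)) :
    d - K ≤ r ∧ r - K ≤ d * (u ⬝ᵥ v) ^ 2 := by
  -- Testing at `v` bounds `r` from below; testing at `u` bounds it by the overlap.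
  have h1 := (abs_le.1 (hAv v)).1
  have h2 := (abs_le.1 (hAv u)).2
  have h3 := h.le v
  rw [h.mulVec_eq, dotProduct_smul, h.dotProduct_self, smul_eq_mul, dotProduct_comm v] at h2
  rw [hv] at h1 h3
  constructor <;> linarith

end IsTopEigenpair

theorem one_sub_le_welfare_div_welfare [NeZero n] (hA : A.IsHermitian) (hA0 : ∀ i j, 0 ≤ A i j)
    (hβ : 0 < β) (hρ : spectralRadius ℝ A < ENNReal.ofReal (1 / β))
    {b v : EuclideanSpace ℝ (Fin n)} (hb : ∀ i, 0 ≤ b i) (hv : ∀ i, 0 ≤ v i) (hv1 : ‖v‖ = 1)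
    {C d ε : ℝ} (hC : 0 < C) (hd : 0 < d) (hε : ε ∈ Set.Ioo (0 : ℝ) 1)
    (hCb : 256 * ‖b‖ ^ 2 / (ε * β * d) ^ 2 ≤ C)
    (hAv : ∀ x : Fin n → ℝ,
      |x ⬝ᵥ A *ᵥ x - d * (v.ofLp ⬝ᵥ x) ^ 2| ≤ ε ^ 2 / 128 * d * (x ⬝ᵥ x)) :
    (∃ y, IsOptimalIntervention A β b C y) ∧ ∀ y, IsOptimalIntervention A β b C y →
      1 - ε ≤ welfare A β b (√C • v) / welfare A β b y := by
  obtain ⟨hε0, hε1⟩ := hε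
  obtain ⟨r, u, h, hr⟩ := exists_isTopEigenpair hA hβ hρ
  refine ⟨h.exists_isOptimalIntervention hβ hr b hC.le, fun y hy => ?_⟩
  have hvv : v.ofLp ⬝ᵥ v.ofLp = 1 := by
    rw [← EuclideanSpace.real_norm_sq_eq_dotProduct, hv1, one_pow]
  obtain ⟨hr1, hr2⟩ := h.le_sq_dotProduct hvv hAv
  have hsC : 0 < √C := Real.sqrt_pos.2 hC
  have hsq : √C ^ 2 = C := Real.sq_sqrt hC.le
  -- The approximation error `ε² d / 128` enters twice, through `hr1` and `hr2`.
  have huv : 1 - ε ^ 2 / 64 ≤ (u ⬝ᵥ v.ofLp) ^ 2 := by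
    refine le_of_mul_le_mul_left ?_ hd
    linarith
  have hlow := h.le_welfare hβ hr hA0 hb (y := √C • v) fun i => mul_nonneg hsC.le (hv i)
  rw [WithLp.ofLp_smul, dotProduct_smul, smul_eq_mul, mul_pow, hsq] at hlow
  -- From `βr < 1` and `r ≥ (1 - 1/128) d`; the value 16/15 turns the 16 = √256 of the budget
  -- condition into 15 below.
  have hβd : β * d ≤ 16 / 15 := by
    have h1 : β * (d - ε ^ 2 / 128 * d) ≤ β * r := mul_le_mul_of_nonneg_left hr1 hβ.le
    have h2 : ε ^ 2 * (β * d) ≤ 1 * (β * d) :=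
      mul_le_mul_of_nonneg_right (by nlinarith) (by positivity)
    linarith
  have hbC : ‖b‖ ≤ √C * (ε / 15) := by
    rw [div_le_iff₀ (by positivity)] at hCb
    have h1 : ‖b‖ ≤ √C * (ε * (β * d) / 16) := by
      refine (sq_le_sq₀ (norm_nonneg _) (by positivity)).1 ?_
      rw [mul_pow, hsq]
      linarith
    refine h1.trans (mul_le_mul_of_nonneg_left ?_ hsC.le)
    nlinarith
  have hyC : ‖y‖ ≤ √C := Real.le_sqrt_of_sq_le hy.1
  have hup := h.welfare_le hβ hr b y
  have hup2 : (‖b‖ + ‖y‖) ^ 2 ≤ C * (1 + ε / 15) ^ 2 := by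
    rw [← hsq, ← mul_pow]
    exact pow_le_pow_left₀ (by positivity) (by linarith) 2
  have hs : 0 < (1 - β * r) ^ 2 := pow_pos (by linarith) 2
  -- Makes the optimal welfare positive, so that the ratio is a genuine quotient.
  have hpos : 0 < welfare A β b (√C • v) := by
    have : 0 < 1 / 2 * (C * (u ⬝ᵥ v.ofLp) ^ 2) := by
      have : 0 < (u ⬝ᵥ v.ofLp) ^ 2 := by nlinarith
      positivity
    exact pos_of_mul_pos_right (this.trans_le hlow) hs.le
  have hfeas : ‖√C • v‖ ^ 2 ≤ C := by
    rw [norm_smul, hv1, mul_one, Real.norm_of_nonneg hsC.le, hsq]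
  rw [le_div_iff₀ (hpos.trans_le (hy.2 _ hfeas))]
  refine le_of_mul_le_mul_left ?_ hs
  have hε' : (1 - ε) * (1 + ε / 15) ^ 2 ≤ 1 - ε ^ 2 / 64 := by nlinarith [pow_pos hε0 3]
  calc (1 - β * r) ^ 2 * ((1 - ε) * welfare A β b y)
      = (1 - ε) * ((1 - β * r) ^ 2 * welfare A β b y) := by ring
    _ ≤ (1 - ε) * (1 / 2 * (C * (1 + ε / 15) ^ 2)) :=
        mul_le_mul_of_nonneg_left (by linarith) (by linarith)
    _ = 1 / 2 * C * ((1 - ε) * (1 + ε / 15) ^ 2) := by ring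
    _ ≤ 1 / 2 * C * (u ⬝ᵥ v.ofLp) ^ 2 :=
        mul_le_mul_of_nonneg_left (hε'.trans huv) (by positivity)
    _ ≤ _ := by linarith

end NetworkGame

/-! ### Concentration of `G(w)` graphs -/

namespace RandomGraph

variable {n : ℕ}

theorem adjacency_isHermitian (g : Sym2 (Fin n) → Bool) : (adjacency g).IsHermitian := by
  ext a b
  simp [adjacency, Sym2.eq_swap]

theorem adjacency_nonneg (g : Sym2 (Fin n) → Bool) (i j : Fin n) : 0 ≤ adjacency g i j := by
  rw [adjacency, Matrix.of_apply]
  split_ifs <;> simp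

variable [NeZero n] {w : EuclideanSpace ℝ (Fin n)}

theorem IsExpectedDegreeSequence.sum_pos (hw : IsExpectedDegreeSequence w) : 0 < ∑ k, w k :=
  Finset.sum_pos (fun k _ => hw.pos k) ⟨0, Finset.mem_univ _⟩

theorem IsExpectedDegreeSequence.le_zero (hw : IsExpectedDegreeSequence w) (i : Fin n) :
    w i ≤ w 0 :=
  hw.antitone 0 i (Fin.zero_le _)

theorem IsExpectedDegreeSequence.norm_pos (hw : IsExpectedDegreeSequence w) : 0 < ‖w‖ :=
  norm_pos_iff.2 fun h => (hw.pos 0).ne' (by simp [h])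

theorem IsExpectedDegreeSequence.secondOrderAverage_le (hw : IsExpectedDegreeSequence w) :
    secondOrderAverage w ≤ w 0 := by
  rw [secondOrderAverage, div_le_iff₀ hw.sum_pos, Finset.mul_sum]
  refine Finset.sum_le_sum fun i _ => ?_
  nlinarith [hw.pos i, hw.le_zero i]

theorem IsExpectedDegreeSequence.sum_gwEdgeProb_le (hw : IsExpectedDegreeSequence w)
    (loops : Bool) (a : Fin n) : ∑ b, gwEdgeProb loops w s(a, b) ≤ w 0 := by
  have hS := hw.sum_pos
  calc ∑ b, gwEdgeProb loops w s(a, b) ≤ ∑ b, w a * w b / ∑ k, w k := by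
        refine Finset.sum_le_sum fun b _ => ?_
        simp only [gwEdgeProb, Sym2.lift_mk]
        have := (hw.pos a).le
        have := (hw.pos b).le
        split_ifs
        · positivity
        · rfl
    _ = w a := by rw [← Finset.sum_div, ← Finset.mul_sum, mul_div_cancel_right₀ _ hS.ne']
    _ ≤ w 0 := hw.le_zero a

/-- Since `∑ wᵢ² = ‖w‖²`, the rank-one matrix is `w wᵀ / ∑ wₖ`. It differs from the mean only by the
excluded loops, a diagonal with entries in `[0, 1]` because `w₁² ≤ ∑ wₖ`. -/
theorem IsExpectedDegreeSequence.abs_dotProduct_gwEdgeProb_sub_le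
    (hw : IsExpectedDegreeSequence w) (loops : Bool) (x : Fin n → ℝ) :
    |x ⬝ᵥ (Matrix.of fun a b => gwEdgeProb loops w s(a, b)) *ᵥ x -
      secondOrderAverage w * (((1 / ‖w‖) • w).ofLp ⬝ᵥ x) ^ 2| ≤ x ⬝ᵥ x := by
  have hS := hw.sum_pos
  have hn := hw.norm_pos
  have hP : (Matrix.of fun a b => gwEdgeProb loops w s(a, b)) =
      (1 / ∑ k, w k) • Matrix.vecMulVec w w -
        Matrix.diagonal fun a => if loops = false then w a ^ 2 / ∑ k, w k else 0 := by
    ext a b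
    by_cases hab : a = b
    · subst hab
      by_cases hl : loops = false <;>
        simp [gwEdgeProb, Matrix.vecMulVec_apply, hl, pow_two] <;> ring
    · simp [gwEdgeProb, Matrix.vecMulVec_apply, hab]
      ring
  have hd : secondOrderAverage w * (((1 / ‖w‖) • w).ofLp ⬝ᵥ x) ^ 2 =
      (1 / ∑ k, w k) * (w.ofLp ⬝ᵥ x) ^ 2 := by
    rw [WithLp.ofLp_smul, smul_dotProduct, smul_eq_mul, secondOrderAverage,
      ← EuclideanSpace.real_norm_sq_eq]
    field_simp
  rw [hP, hd, Matrix.sub_mulVec, Matrix.smul_mulVec, dotProduct_sub, dotProduct_smul,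
    Matrix.vecMulVec_mulVec, smul_eq_mul]
  have hD0 : 0 ≤ x ⬝ᵥ (Matrix.diagonal fun a => if loops = false then w a ^ 2 / ∑ k, w k else 0)
      *ᵥ x := by
    simp only [Matrix.mulVec_diagonal, dotProduct]
    refine Finset.sum_nonneg fun a _ => ?_
    rw [mul_left_comm]
    refine mul_nonneg ?_ (mul_self_nonneg _)
    split_ifs <;> positivity
  have hD1 : x ⬝ᵥ (Matrix.diagonal fun a => if loops = false then w a ^ 2 / ∑ k, w k else 0)
      *ᵥ x ≤ x ⬝ᵥ x := by
    simp only [Matrix.mulVec_diagonal, dotProduct]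
    refine Finset.sum_le_sum fun a _ => ?_
    rw [mul_left_comm]
    refine mul_le_of_le_one_left (mul_self_nonneg _) ?_
    split_ifs
    · rw [div_le_one hS]
      exact (Real.le_sqrt (hw.pos a).le hS.le).1 ((hw.le_zero a).trans hw.le_sqrt)
    · exact zero_le_one
  have hx : x ⬝ᵥ (MulOpposite.op (w.ofLp ⬝ᵥ x) • w.ofLp) = (w.ofLp ⬝ᵥ x) ^ 2 := by
    rw [dotProduct_smul, dotProduct_comm x, MulOpposite.smul_eq_mul_unop, MulOpposite.unop_op,
      pow_two]
  rw [hx, abs_le]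
  constructor <;> linarith

theorem GwConcentration.secondOrderAverage_pos {ε δ : ℝ} (hconc : GwConcentration w ε δ) :
    0 < secondOrderAverage w := by
  have := hconc.eps_mem.1
  exact lt_of_lt_of_le (by positivity) hconc.le_secondOrderAverage

/-- With probability at least `1 - δ`, the adjacency matrix of a `G(w)` graph is close to a
rank-one matrix with the direction of `w`. -/
theorem GwConcentration.measure_compl_le {ε δ : ℝ} (hw : IsExpectedDegreeSequence w)
    (hconc : GwConcentration w ε δ) (loops : Bool) :
    gw loops w {g | ∀ x : Fin n → ℝ,
      |x ⬝ᵥ adjacency g *ᵥ x - secondOrderAverage w * (((1 / ‖w‖) • w).ofLp ⬝ᵥ x) ^ 2| ≤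
        ε ^ 2 / 128 * secondOrderAverage w * (x ⬝ᵥ x)}ᶜ ≤ ENNReal.ofReal δ := by
  obtain ⟨hε0, hε1⟩ := hconc.eps_mem
  obtain ⟨hδ0, hδ1⟩ := hconc.delta_mem
  have hd := hconc.secondOrderAverage_pos
  have hw0 := hw.pos 0
  have hn : (1 : ℝ) ≤ n := by exact_mod_cast NeZero.one_le
  set L := Real.log (2 * n / δ)
  have hL : 0 < L := Real.log_pos (by rw [lt_div_iff₀ hδ0]; linarith)
  have hcon : 256 * (√(4 * w 0 * L) + 1) ≤ secondOrderAverage w * ε ^ 2 := by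
    have := hconc.le_secondOrderAverage
    rwa [div_le_iff₀ (by positivity)] at this
  set R := √(4 * w 0 * L)
  have hR0 : 0 < R := Real.sqrt_pos.2 (by positivity)
  have hR : R ^ 2 = 4 * w 0 * L := Real.sq_sqrt (by positivity)
  have hRw : 256 * R ≤ w 0 := by
    have h1 := hw.secondOrderAverage_le
    have h2 : secondOrderAverage w * ε ^ 2 ≤ secondOrderAverage w * 1 :=
      mul_le_mul_of_nonneg_left (by nlinarith) hd.le
    linarith
  -- This `θ` balances `L / θ` and `2θ w₁` up to a constant: they become `R` and `R / 2`.
  have hθ : R / (4 * w 0) ≤ 1 / 2 := by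
    rw [div_le_iff₀ (by positivity)]; linarith
  have hp : ∀ e, (Set.projIcc (0 : ℝ) 1 zero_le_one (gwEdgeProb loops w e) : ℝ) =
      gwEdgeProb loops w e := fun e => by
    rw [Set.projIcc_of_mem _ (gwEdgeProb_mem loops hw e)]
  have h := measure_adjacency_sub_le (θ := R / (4 * w 0)) (t := L) (Δ := w 0) (by positivity) hθ
    (fun e => Set.projIcc 0 1 zero_le_one (gwEdgeProb loops w e)) (fun a => by
      simpa only [hp] using hw.sum_gwEdgeProb_le loops a)
  have hδ : 2 * n * Real.exp (-L) = δ := by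
    rw [Real.exp_neg, Real.exp_log (by positivity)]
    field_simp
  have hc : L / (R / (4 * w 0)) + 2 * (R / (4 * w 0)) * w 0 = 3 / 2 * R := by
    field_simp
    linear_combination (-8) * hR
  rw [hδ, hc] at h
  refine (measure_mono (Set.compl_subset_compl.2 fun g hg x => ?_)).trans h
  have h1 := hg x
  simp only [hp] at h1
  have h2 := hw.abs_dotProduct_gwEdgeProb_sub_le loops x
  have hx : 0 ≤ x ⬝ᵥ x := Finset.sum_nonneg fun _ _ => mul_self_nonneg _
  rw [Matrix.sub_mulVec, dotProduct_sub] at h1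
  refine (abs_sub_le _ _ _).trans ((add_le_add h1 h2).trans ?_)
  -- The total error `3R/2 + 1` is at most `2(R + 1)`, which `hcon` bounds by `ε² d̃ / 128`.
  nlinarith

end RandomGraph

/-! ### The main theorem -/

theorem mainTheorem2 {n : ℕ} [NeZero n] (w b : EuclideanSpace ℝ (Fin n)) (ε δ β C : ℝ)
    (loops : Bool)
    (hw : RandomGraph.IsExpectedDegreeSequence w)
    (hconc : RandomGraph.GwConcentration w ε δ)
    (hb : ∀ i, 0 ≤ b i) (hβ : 0 < β) (hC : 0 < C)
    (hCb : 256 * ‖b‖ ^ 2 / (ε * β * RandomGraph.secondOrderAverage w) ^ 2 ≤ C) :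
    ENNReal.ofReal (1 - δ) ≤ RandomGraph.gw loops w
      {g | spectralRadius ℝ (RandomGraph.adjacency g) < ENNReal.ofReal (1 / β) →
        (∃ y, NetworkGame.IsOptimalIntervention (RandomGraph.adjacency g) β b C y) ∧
        ∀ y, NetworkGame.IsOptimalIntervention (RandomGraph.adjacency g) β b C y →
          1 - ε ≤ NetworkGame.welfare (RandomGraph.adjacency g) β b ((√C / ‖w‖) • w) /
            NetworkGame.welfare (RandomGraph.adjacency g) β b y} := by
  have : IsProbabilityMeasure (RandomGraph.gw loops w) := by
    unfold RandomGraph.gw RandomGraph.independentEdges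
    infer_instance
  have hbad := hconc.measure_compl_le hw loops
  rw [ENNReal.ofReal_sub _ hconc.delta_mem.1.le, ENNReal.ofReal_one]
  refine (tsub_le_tsub_left hbad _).trans ?_
  rw [← prob_compl_eq_one_sub MeasurableSet.of_discrete, compl_compl]
  refine measure_mono fun g hg hρ => ?_
  have hv1 : ‖(1 / ‖w‖) • w‖ = 1 := by
    rw [norm_smul, Real.norm_of_nonneg (by positivity), one_div, inv_mul_cancel₀ hw.norm_pos.ne']
  have hmain := NetworkGame.one_sub_le_welfare_div_welfare (RandomGraph.adjacency_isHermitian g)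
    (RandomGraph.adjacency_nonneg g) hβ hρ hb (v := (1 / ‖w‖) • w)
    (fun i => mul_nonneg (by positivity) (hw.pos i).le) hv1 hC hconc.secondOrderAverage_pos
    hconc.eps_mem hCb hg
  rwa [smul_smul, mul_one_div] at hmain
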